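/- Let $G$ be a totally disconnected, locally compact group. A Cayley--Abels graph for $G$ is a connected, locally finite simple graph on which $G$ acts vertex-transitively by automorphisms with compact open vertex stabilizers. If $G$ is compactly generated, $\mathrm{md}(G)$ denotes the minimal degree of a Cayley--Abels graph for $G$. The automorphism group $\mathrm{Aut}(T)$ of a graph $T$ carries the permutation topology (pointwise convergence on the discrete set of vertices), and subgroups carry the subspace topology. An end of a tree $T$ is an equivalence class of rays (one-way infinite paths with distinct vertices), two rays being equivalent if they have a common infinite tail; for an end $\omega$, a subscript $\omega$ denotes the stabilizer of $\omega$. Let $d, d' \ge 2$ be integers. 1. Suppose $d \neq d'$. Let $T_{d,d'}$ be the $(d,d')$-bi-regular tree (all vertices in one part of its natural bipartition have degree $d$ and all vertices in the other part have degree $d'$), and let $\omega$ be an end of $T_{d,d'}$. Then $\mathrm{Aut}(T_{d,d'})_\omega$ is a compactly generated, totally disconnected, locally compact group, and $$\mathrm{md}(\mathrm{Aut}(T_{d,d'})_\omega) = (d-1)(d'-1)+1 .$$ 2. Let $T_d$ be the $d$-regular tree, $\omega$ an end of $T_d$, and $\mathrm{Aut}^+(T_d)$ the group of automorphisms of $T_d$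 that leave each part of the natural bipartition of the vertex set invariant. Then $\mathrm{Aut}^+(T_d)_\omega$ is a compactly generated, totally disconnected, locally compact group, and $$\mathrm{md}(\mathrm{Aut}^+(T_d)_\omega) = (d-1)^2+1 .$$ 3. For $T_d$ and $\omega$ as in 2, $\mathrm{Aut}(T_d)_\omega$ is a compactly generated, totally disconnected, locally compact group, and $$\mathrm{md}(\mathrm{Aut}(T_d)_\omega) = d .$$ -/

import Mathlib

universe u

namespace MinimalDegree

/-! ### Cayley–Abels graphs and the minimal degree -/

/-- A compactly generated, totally disconnected, locally compact topological group. -/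
structure IsCompactlyGeneratedTDLC (G : Type*) [Group G] [TopologicalSpace G] : Prop where
  isTopologicalGroup : IsTopologicalGroup G
  locallyCompactSpace : LocallyCompactSpace G
  totallyDisconnectedSpace : TotallyDisconnectedSpace G
  compactlyGenerated : ∃ K : Set G, IsCompact K ∧ Subgroup.closure K = ⊤

/-- The locally finite graph `Γ`, with an action of `G` on its vertex set, is a Cayley–Abels graph
for `G`: it is connected, `G` acts by graph automorphisms and vertex-transitively, and the vertex
stabilizers are compact and open. -/
structure IsCayleyAbelsGraph (G : Type*) [Group G] [TopologicalSpace G] {W : Type*}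
    [MulAction G W] (Γ : SimpleGraph W) [Γ.LocallyFinite] : Prop where
  connected : Γ.Connected
  adj_smul_iff : ∀ (g : G) (a b : W), Γ.Adj (g • a) (g • b) ↔ Γ.Adj a b
  vertexTransitive : MulAction.IsPretransitive G W
  isCompact_stabilizer : ∀ a : W, IsCompact (MulAction.stabilizer G a : Set G)
  isOpen_stabilizer : ∀ a : W, IsOpen (MulAction.stabilizer G a : Set G)

/-- The set of the degrees of the Cayley–Abels graphs for `G`. The vertex set of such a graph is
in bijection with a coset space of `G`, so nothing is lost by taking it in the universe of `G`. -/
def cayleyAbelsDegrees (G : Type u) [Group G] [TopologicalSpace G] : Set ℕ :=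
  {n | ∃ (W : Type u) (_ : MulAction G W) (Γ : SimpleGraph W) (_ : Γ.LocallyFinite),
    IsCayleyAbelsGraph G Γ ∧ Γ.IsRegularOfDegree n}

/-- The minimal degree `md(G)` of a Cayley–Abels graph for `G`. (A value other than `0` is attained,
since the infimum of the empty set of natural numbers is `0`.) -/
noncomputable def md (G : Type u) [Group G] [TopologicalSpace G] : ℕ :=
  sInf (cayleyAbelsDegrees G)

/-! ### Automorphism groups of graphs with the permutation topology -/

variable {V : Type*}

/-- The permutation topology on `Aut(T)`: the topology of pointwise convergence on the discrete set
of vertices. A neighbourhood basis of `g` is given by the sets `{h | ∀ v ∈ Φ, h v = g v}`, for the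
finite sets `Φ` of vertices. -/
instance permutationTopology (T : SimpleGraph V) : TopologicalSpace (T ≃g T) :=
  TopologicalSpace.induced (fun (g : T ≃g T) (v : V) => g v)
    (@Pi.topologicalSpace V (fun _ => V) (fun _ => ⊥))

/-- The part of the natural bipartition of the tree `T` that contains the vertex `v`. -/
def bipartitionPart (T : SimpleGraph V) (v : V) : Set V := {w | Even (T.dist v w)}

/-- `Aut⁺(T)`: the automorphisms that leave each part of the natural bipartition invariant. -/
def autPlus (T : SimpleGraph V) : Subgroup (T ≃g T) where
  carrier := {g | ∀ v w : V, g w ∈ bipartitionPart T v ↔ w ∈ bipartitionPart T v}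
  one_mem' := fun _ _ => Iff.rfl
  mul_mem' := fun {g h} hg hh v w => (hg v (h w)).trans (hh v w)
  inv_mem' := fun {g} hg v w => by
    have h := hg v (g⁻¹ w)
    rw [RelIso.apply_inv_self] at h
    exact h.symm

/-- The tree `T` is `(d, d')`-bi-regular: all vertices in one part of its bipartition have degree `d`
and all vertices in the other part have degree `d'`. -/
def IsBiregular (T : SimpleGraph V) [T.LocallyFinite] (d d' : ℕ) : Prop :=
  ∃ A : Set V, (∀ v w : V, T.Adj v w → (v ∈ A ↔ w ∉ A)) ∧
    (∀ v ∈ A, T.degree v = d) ∧ (∀ v ∉ A, T.degree v = d')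

/-! ### Ends of trees -/

/-- A ray: a one-way infinite path with pairwise distinct vertices. -/
structure Ray (T : SimpleGraph V) where
  vertex : ℕ → V
  adj : ∀ n, T.Adj (vertex n) (vertex (n + 1))
  injective : Function.Injective vertex

/-- Two rays in a tree are equivalent if they have a common infinite tail. -/
instance raySetoid (T : SimpleGraph V) : Setoid (Ray T) where
  r R S := ∃ k l : ℕ, ∀ n : ℕ, R.vertex (k + n) = S.vertex (l + n)
  iseqv :=
    { refl := fun _ => ⟨0, 0, fun _ => rfl⟩
      symm := fun ⟨k, l, h⟩ => ⟨l, k, fun n => (h n).symm⟩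
      trans := fun {R S Q} ⟨k, l, h⟩ ⟨k', l', h'⟩ => ⟨k + k', l' + l, fun n => by
        rw [Nat.add_assoc, h, Nat.add_assoc, ← h']
        congr 1
        omega⟩ }

/-- The ends of a tree `T`: the equivalence classes of rays. -/
def TreeEnd (T : SimpleGraph V) : Type _ := Quotient (raySetoid T)

/-- `Aut(T)` acts on the rays of `T`. -/
instance rayAction (T : SimpleGraph V) : MulAction (T ≃g T) (Ray T) where
  smul g R := ⟨fun n => g (R.vertex n), fun n => g.map_adj_iff.mpr (R.adj n),
    g.injective.comp R.injective⟩
  one_smul _ := rfl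
  mul_smul _ _ _ := rfl

/-- `Aut(T)` acts on the ends of `T`. -/
instance treeEndAction (T : SimpleGraph V) : MulAction (T ≃g T) (TreeEnd T) where
  smul g := Quotient.map (fun R : Ray T => g • R)
    (fun _ _ ⟨k, l, h⟩ => ⟨k, l, fun n => congrArg g (h n)⟩)
  one_smul := fun ω => Quotient.inductionOn ω fun _ => rfl
  mul_smul := fun _ _ ω => Quotient.inductionOn ω fun _ => rfl

/-- The end stabilizer `Aut(T)_ω`. -/
def endStabilizer (T : SimpleGraph V) (ω : TreeEnd T) : Subgroup (T ≃g T) :=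
  MulAction.stabilizer (T ≃g T) ω

/-- The stabilizer `Aut⁺(T)_ω` of the end `ω` in `Aut⁺(T)`. -/
def endStabilizerPlus (T : SimpleGraph V) (ω : TreeEnd T) : Subgroup (T ≃g T) :=
  autPlus T ⊓ endStabilizer T ω

end MinimalDegree

namespace MinimalDegree

/-! ### The parent map defined by an end of a tree -/

/-! An end turns the tree into a genealogy: each vertex `v` has a parent `p v`, its neighbour
towards the end, and a Busemann level `h v`. The stabilizer of the end consists of the automorphisms
commuting with `p` (`exists_isParentMap`). All the groups in question are cut out by commuting with
`p` and preserving levels modulo `r`: `r = 1` gives the full stabilizer in the regular case, `r = 2`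
the part-preserving one, which for `d ≠ d'` is the full stabilizer too.

Let `Q` be the number of `r`-fold descendants of a vertex. Joining vertices on every `r`-th level to
their `r`-th ancestors gives a Cayley–Abels graph of degree `Q + 1`. Transitivity is
`IsParentMap.exists_iso`, and compactness of stabilizers is a Tychonoff argument.

For the lower bound, the level shift is a homomorphism to the integers that vanishes on vertex
stabilizers of any Cayley–Abels graph, as they are compact. Connectedness yields a vertex `a`
adjacent to `g • a` with positive shift. The neighbours of `a` with the opposite shift include the
orbit of `g⁻¹ • a` under the stabilizer of `a`. The orbit's size is at least the Haar modular factor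
of `g`, a quantity independent of the compact open subgroup used to compute it; on a stabilizer of a
tree vertex it counts descendants, so it is at least `Q`. The neighbour `g • a` adds one
(`IsCayleyAbelsGraph.lt_degree`). -/

/-- The map `p` sends every vertex of `T` to its neighbour in the direction of a fixed end, and the
level function `h` increases by one in this direction. -/
structure IsParentMap {V : Type*} (T : SimpleGraph V) (p : V → V) (h : V → ℤ) : Prop where
  adj_iff : ∀ v w, T.Adj v w ↔ w = p v ∨ v = p w
  level : ∀ v, h (p v) = h v + 1
  common : ∀ v w, ∃ m n, p^[m] v = p^[n] w

section Tree

variable {V : Type*} {T : SimpleGraph V}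

/-- Any neighbour of `v` closer to `x` must be the penultimate vertex of the path from `x` to `v`.
-/
theorem eq_of_adj_of_dist_lt (hT : T.IsTree) {x v w w' : V} (hw : T.Adj v w) (hw' : T.Adj v w')
    (h : T.dist x w < T.dist x v) (h' : T.dist x w' < T.dist x v) : w = w' := by
  classical
  obtain ⟨q, hq, -⟩ := hT.connected.exists_path_of_dist x v
  have key : ∀ u, T.Adj v u → T.dist x u < T.dist x v → u = q.penultimate := by
    intro u hu hlt
    obtain ⟨s, hs, hs'⟩ := hT.connected.exists_path_of_dist x u
    refine hT.isAcyclic.eq_penultimate_of_adj_end hq hu ?_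
    refine hT.isAcyclic.mem_support_of_ne_mem_support_of_adj_of_isPath hq hs hu fun hv => ?_
    have := (SimpleGraph.dist_le (s.takeUntil v hv)).trans (s.length_takeUntil_le_length hv)
    omega
  rw [key w hw h, key w' hw' h']

theorem exists_adj_dist_lt (hT : T.IsTree) {x v : V} (hxv : x ≠ v) :
    ∃ w, T.Adj v w ∧ T.dist x w + 1 = T.dist x v := by
  obtain ⟨q, hq⟩ := hT.connected.exists_walk_length_eq_dist v x
  cases q with
  | nil => exact absurd rfl hxv
  | cons hadj q =>
    rename_i w
    refine ⟨w, hadj, ?_⟩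
    have h1 := SimpleGraph.dist_le q
    rw [SimpleGraph.Walk.length_cons] at hq
    rw [T.dist_comm] at h1 hq
    have := hT.dist_eq_dist_add_one_of_adj x hadj
    omega

/-- If the distance dropped at some step, the vertex there would have two closer neighbours, its
predecessor and its successor on the ray, which would then coincide. -/
theorem Ray.dist_vertex_add (hT : T.IsTree) (R : Ray T) (n k : ℕ) :
    T.dist (R.vertex n) (R.vertex (n + k)) = k := by
  induction k using Nat.strong_induction_on with
  | _ k ih =>
    match k with
    | 0 => simp
    | 1 => exact SimpleGraph.dist_eq_one_iff_adj.mpr (R.adj n)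
    | k + 2 =>
      have h0 := ih k (by omega)
      have h1 := ih (k + 1) (by omega)
      rcases hT.dist_eq_dist_add_one_of_adj (R.vertex n) (R.adj (n + (k + 1))) with h | h
      · have := eq_of_adj_of_dist_lt hT (x := R.vertex n) (R.adj (n + (k + 1)))
          (R.adj (n + k)).symm (by omega)
          (show T.dist _ (R.vertex (n + k)) < T.dist _ (R.vertex (n + (k + 1))) by omega)
        have := R.injective this
        omega
      · rw [show n + (k + 2) = n + (k + 1) + 1 by omega, h, h1]

theorem exists_eventually_eq_of_antitone {f : ℕ → ℤ} (hf : Antitone f) {b : ℤ}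
    (hb : ∀ n, b ≤ f n) : ∃ z : ℤ, ∃ N, ∀ n ≥ N, f n = z := by
  obtain ⟨z, ⟨N, rfl⟩, hz⟩ := Int.exists_least_of_bdd (P := fun z => ∃ n, f n = z)
    ⟨b, by rintro _ ⟨n, rfl⟩; exact hb n⟩ ⟨_, 0, rfl⟩
  exact ⟨f N, N, fun n hn => le_antisymm (hf hn) (hz _ ⟨n, rfl⟩)⟩

/-- The Busemann function of the ray: by the triangle inequality, distance minus `n` is antitone and
bounded below, hence eventually constant. -/
theorem Ray.exists_busemann (hT : T.IsTree) (R : Ray T) (v : V) :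
    ∃ z : ℤ, ∃ N : ℕ, ∀ n ≥ N, (T.dist (R.vertex n) v : ℤ) = z + n := by
  obtain ⟨z, N, h⟩ := exists_eventually_eq_of_antitone
    (f := fun n => (T.dist (R.vertex n) v : ℤ) - n) (b := -T.dist (R.vertex 0) v)
    (antitone_nat_of_succ_le fun n => by
      have := hT.connected.dist_triangle (u := R.vertex (n + 1)) (v := R.vertex n) (w := v)
      rw [T.dist_comm (u := R.vertex (n + 1)) (v := R.vertex n), R.dist_vertex_add hT n 1] at this
      push_cast
      omega)
    (fun n => by
      have := hT.connected.dist_triangle (u := R.vertex 0) (v := v) (w := R.vertex n)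
      have h0 := R.dist_vertex_add hT 0 n
      rw [zero_add] at h0
      rw [h0, T.dist_comm (u := v)] at this
      omega)
  exact ⟨z, N, fun n hn => by have := h n hn; omega⟩

theorem exists_isParentMap (hT : T.IsTree) (ω : TreeEnd T) :
    ∃ (p : V → V) (h : V → ℤ), IsParentMap T p h ∧
      ∀ g : T ≃g T, g ∈ endStabilizer T ω ↔ ∀ v, g (p v) = p (g v) := by
  induction ω using Quotient.inductionOn with | _ R
  choose b hb using R.exists_busemann hT
  have badj : ∀ {v w}, T.Adj v w → b v = b w + 1 ∨ b w = b v + 1 := fun {v w} hvw => by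
    obtain ⟨N, hN⟩ := hb v
    obtain ⟨M, hM⟩ := hb w
    have h1 := hN (max N M) (le_max_left ..)
    have h2 := hM (max N M) (le_max_right ..)
    have := hT.dist_eq_dist_add_one_of_adj (R.vertex (max N M)) hvw
    omega
  have hex : ∀ v, ∃ w, T.Adj v w ∧ b v = b w + 1 := fun v => by
    obtain ⟨N, hN⟩ := hb v
    obtain ⟨n, hn, hne⟩ : ∃ n ≥ N, R.vertex n ≠ v := by
      by_cases h : R.vertex N = v
      · exact ⟨N + 1, by omega, fun h' => by have := R.injective (h.trans h'.symm); omega⟩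
      · exact ⟨N, le_rfl, h⟩
    obtain ⟨w, hvw, hd⟩ := exists_adj_dist_lt hT hne
    -- A neighbour closer to one far ray vertex stays closer to all later ones by the triangle
    -- inequality, so its Busemann value cannot go up.
    refine ⟨w, hvw, (badj hvw).resolve_right fun hbw => ?_⟩
    obtain ⟨M, hM⟩ := hb w
    have h1 := hN n hn
    have h2 := hM (n + M) (by omega)
    have h3 := hT.connected.dist_triangle (u := R.vertex (n + M)) (v := R.vertex n) (w := w)
    rw [T.dist_comm (u := R.vertex (n + M)) (v := R.vertex n), R.dist_vertex_add hT n M] at h3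
    push_cast at h2
    omega
  have huniq : ∀ {v w w'}, T.Adj v w → T.Adj v w' → b v = b w + 1 → b v = b w' + 1 → w = w' := by
    intro v w w' hw hw' h h'
    obtain ⟨N, hN⟩ := hb v
    obtain ⟨M, hM⟩ := hb w
    obtain ⟨M', hM'⟩ := hb w'
    have h1 := hN (N + M + M') (by omega)
    have h2 := hM (N + M + M') (by omega)
    have h3 := hM' (N + M + M') (by omega)
    exact eq_of_adj_of_dist_lt hT (x := R.vertex (N + M + M')) hw hw' (by omega) (by omega)
  choose p hpadj hp using hex
  have hadj : ∀ v w, T.Adj v w ↔ w = p v ∨ v = p w := fun v w => by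
    refine ⟨fun h => ?_, ?_⟩
    · rcases badj h with h' | h'
      · exact Or.inl (huniq h (hpadj v) h' (hp v))
      · exact Or.inr (huniq h.symm (hpadj w) h' (hp w))
    · rintro (rfl | rfl)
      · exact hpadj v
      · exact (hpadj w).symm
  have hcommon : ∀ v w, ∃ m n, p^[m] v = p^[n] w := fun v w => by
    obtain ⟨q⟩ := hT.connected v w
    induction q with
    | nil => exact ⟨0, 0, rfl⟩
    | @cons u v w huv q ih =>
      obtain ⟨m, n, h⟩ := ih
      rcases (hadj u v).mp huv with rfl | rfl
      · exact ⟨m + 1, n, h⟩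
      · refine ⟨m, n + 1, ?_⟩
        rw [Function.iterate_succ_apply', ← h, ← Function.iterate_succ_apply' p,
          Function.iterate_succ_apply]
  have hray : ∀ n, R.vertex (n + 1) = p (R.vertex n) := fun n => by
    refine huniq (R.adj n) (hpadj _) ?_ (hp _)
    have key : ∀ k, b (R.vertex k) = -k := fun k => by
      obtain ⟨N, hN⟩ := hb (R.vertex k)
      have := hN (k + N) (by omega)
      rw [T.dist_comm, R.dist_vertex_add hT k N] at this
      push_cast at this
      omega
    rw [key, key]
    push_cast
    omega
  have hrayk : ∀ k n, R.vertex (n + k) = p^[k] (R.vertex n) := fun k n => by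
    induction k with
    | zero => rfl
    | succ k ih => rw [← add_assoc, hray, ih, Function.iterate_succ_apply']
  refine ⟨p, fun v => -b v, ⟨hadj, fun v => by have := hp v; omega, hcommon⟩, fun g => ?_⟩
  have hmem : g ∈ endStabilizer T ⟦R⟧ ↔ ∃ k l : ℕ, ∀ n : ℕ,
      g (R.vertex (k + n)) = R.vertex (l + n) := by
    exact MulAction.mem_stabilizer_iff.trans (Quotient.eq (r := raySetoid T))
  rw [hmem]
  constructor
  · rintro ⟨k, l, hkl⟩
    have hdist : ∀ x y, T.dist (g x) (g y) = T.dist x y := fun x y => by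
      have hle : ∀ (f : T ≃g T) x y, T.dist (f x) (f y) ≤ T.dist x y := fun f x y => by
        obtain ⟨q, hq⟩ := hT.connected.exists_walk_length_eq_dist x y
        rw [← hq]
        have := SimpleGraph.dist_le (q.map f.toHom)
        rwa [SimpleGraph.Walk.length_map] at this
      refine le_antisymm (hle g x y) ?_
      have := hle g⁻¹ (g x) (g y)
      rwa [RelIso.inv_apply_self, RelIso.inv_apply_self] at this
    -- An automorphism shifting a tail of the ray changes the Busemann function by a constant, so it
    -- respects the unique descending neighbour.
    have hbg : ∀ v, b (g v) = b v + (k - l) := fun v => by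
      obtain ⟨N, hN⟩ := hb v
      obtain ⟨M, hM⟩ := hb (g v)
      have h1 := hN (k + (N + M)) (by omega)
      have h2 := hM (l + (N + M)) (by omega)
      rw [← hkl, hdist] at h2
      push_cast at h1 h2
      omega
    intro v
    refine huniq (g.map_adj_iff.mpr (hpadj v)) (hpadj _) ?_ (hp _)
    rw [hbg, hbg, hp v]
    omega
  · intro hg
    have hgk : ∀ k v, g (p^[k] v) = p^[k] (g v) := fun k v => by
      induction k with
      | zero => rfl
      | succ k ih => rw [Function.iterate_succ_apply', hg, ih, Function.iterate_succ_apply']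
    obtain ⟨k, l, hkl⟩ := hcommon (g (R.vertex 0)) (R.vertex 0)
    refine ⟨k, l, fun n => ?_⟩
    have h1 := hrayk (k + n) 0
    have h2 := hrayk (l + n) 0
    rw [zero_add] at h1 h2
    rw [h1, h2, hgk, add_comm k, add_comm l, Function.iterate_add_apply,
      Function.iterate_add_apply _ n l, hkl]

end Tree

/-! ### Automorphisms commuting with the parent map -/

section Extension

variable {V : Type*} {T : SimpleGraph V} {p : V → V} {h : V → ℤ}

theorem IsParentMap.level_iterate (H : IsParentMap T p h) (n : ℕ) (v : V) :
    h (p^[n] v) = h v + n := by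
  induction n with
  | zero => simp
  | succ n ih =>
    rw [Function.iterate_succ_apply', H.level, ih]
    push_cast
    ring

theorem exists_bijOn_fiber (hfin : ∀ v, (p ⁻¹' {v}).Finite) {u u' : V}
    (hc : (p ⁻¹' {u}).ncard = (p ⁻¹' {u'}).ncard) (x x' : V) :
    ∃ φ : V → V, Set.BijOn φ (p ⁻¹' {u}) (p ⁻¹' {u'}) ∧ (p x = u → p x' = u' → φ x = x') := by
  classical
  have : Nonempty V := ⟨u⟩
  obtain ⟨f, hf⟩ := (hfin u).exists_bijOn_of_encard_eq (t := p ⁻¹' {u'}) (by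
    rw [← (hfin u).cast_ncard_eq, ← (hfin u').cast_ncard_eq, hc])
  by_cases hx : p x = u ∧ p x' = u'
  · obtain ⟨rfl, rfl⟩ := hx
    -- A transposition inside the target fiber corrects an arbitrary bijection so that `x` goes to
    -- `x'`.
    refine ⟨Equiv.swap (f x) x' ∘ f, Set.BijOn.comp (t := p ⁻¹' {p x'}) ?_ hf, fun _ _ => by simp⟩
    have hfx : p (f x) = p x' := hf.mapsTo rfl
    have hmaps : Set.MapsTo (Equiv.swap (f x) x') (p ⁻¹' {p x'}) (p ⁻¹' {p x'}) := by
      intro y hy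
      by_cases h1 : y = f x
      · simp [h1]
      · by_cases h2 : y = x'
        · simp [h2, hfx]
        · rwa [Equiv.swap_apply_of_ne_of_ne h1 h2]
    exact ⟨hmaps, (Equiv.injective _).injOn,
      fun y hy => ⟨Equiv.swap (f x) x' y, hmaps hy, Equiv.swap_apply_self ..⟩⟩
  · exact ⟨f, hf, fun h1 h2 => absurd ⟨h1, h2⟩ hx⟩

/-- A vertex can be moved to any other vertex with isomorphic sets of descendants by an
automorphism that commutes with the parent map. -/
theorem IsParentMap.exists_iso (H : IsParentMap T p h) (hfin : ∀ v, (p ⁻¹' {v}).Finite) {r : ℤ}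
    (hc : ∀ v w, r ∣ h v - h w → (p ⁻¹' {v}).ncard = (p ⁻¹' {w}).ncard) {v w : V}
    (hvw : r ∣ h v - h w) :
    ∃ g : T ≃g T, (∀ x, g (p x) = p (g x)) ∧ (∀ x, h (g x) = h x + (h w - h v)) ∧ g v = w := by
  classical
  -- Fiber bijections chosen once and for all, normalized to carry the ancestor line of `v` to that
  -- of `w`. Levels determine `n`, so each fiber carries at most one constraint.
  have hφ : ∀ u u', r ∣ h u - h u' → ∃ φ : V → V, Set.BijOn φ (p ⁻¹' {u}) (p ⁻¹' {u'}) ∧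
      ∀ n, p^[n + 1] v = u → p^[n + 1] w = u' → φ (p^[n] v) = p^[n] w := fun u u' huu' => by
    by_cases hn : ∃ n, p^[n + 1] v = u
    · obtain ⟨n, rfl⟩ := hn
      obtain ⟨φ, hφ, hx⟩ := exists_bijOn_fiber hfin (hc _ _ huu') (p^[n] v) (p^[n] w)
      refine ⟨φ, hφ, fun m hm hm' => ?_⟩
      have := congrArg h hm
      rw [H.level_iterate, H.level_iterate] at this
      obtain rfl : m = n := by omega
      exact hx (Function.iterate_succ_apply' ..).symm
        ((Function.iterate_succ_apply' ..).symm.trans hm')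
    · obtain ⟨φ, hφ, -⟩ := exists_bijOn_fiber hfin (hc _ _ huu') v v
      exact ⟨φ, hφ, fun n h' => absurd ⟨n, h'⟩ hn⟩
  choose! φ hφ hφ' using hφ
  -- `N x` is the number of steps from `x` up to the ancestor line of `v`. The map is prescribed on
  -- that line, where the level says which ancestor `x` is, and is extended downwards by recursion
  -- on `N`.
  let N : V → ℕ := fun x => Nat.find (H.common x v)
  let F : ℕ → V → V := fun n => n.rec (fun x => p^[(h x - h v).toNat] w)
    (fun _ f x => φ (p x) (f (p x)) x)
  let g : V → V := fun x => F (N x) x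
  have hN0 : ∀ x, N x = 0 → ∃ m, x = p^[m] v := fun x hx => by
    have := Nat.find_spec (H.common x v)
    rwa [show Nat.find (H.common x v) = 0 from hx] at this
  have hNs : ∀ n x, N x = n + 1 → N (p x) = n := fun n x hx => by
    have hspec := Nat.find_spec (H.common x v)
    rw [show Nat.find (H.common x v) = n + 1 from hx] at hspec
    refine (Nat.find_eq_iff _).mpr ⟨hspec, fun k hk ⟨m, hm⟩ => ?_⟩
    exact Nat.find_min (H.common x v) (m := k + 1) (by
      rw [show Nat.find (H.common x v) = n + 1 from hx]; omega) ⟨m, hm⟩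
  have gbase : ∀ m, g (p^[m] v) = p^[m] w := fun m => by
    have : N (p^[m] v) = 0 := (Nat.find_eq_zero _).mpr ⟨m, rfl⟩
    change F (N (p^[m] v)) (p^[m] v) = _
    rw [this]
    change p^[(h (p^[m] v) - h v).toNat] w = _
    rw [H.level_iterate, show (h v + m - h v).toNat = m by omega]
  have gstep : ∀ n x, N x = n + 1 → g x = φ (p x) (g (p x)) x := fun n x hx => by
    simp only [g, hx, hNs n x hx]
    rfl
  have glevel : ∀ n x, N x = n → h (g x) = h x + (h w - h v) := fun n => by
    induction n with
    | zero =>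
      intro x hx
      obtain ⟨m, rfl⟩ := hN0 x hx
      rw [gbase, H.level_iterate, H.level_iterate]
      ring
    | succ n ih =>
      intro x hx
      have h1 := ih (p x) (hNs n x hx)
      have h2 : p (φ (p x) (g (p x)) x) = g (p x) := (hφ (p x) (g (p x)) (by
        rw [h1]; convert hvw using 1; ring)).mapsTo rfl
      rw [← gstep n x hx] at h2
      have h3 := H.level (g x)
      rw [h2, h1, H.level] at h3
      omega
  replace glevel : ∀ x, h (g x) = h x + (h w - h v) := fun x => glevel _ x rfl
  have hdvd : ∀ x, r ∣ h x - h (g x) := fun x => by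
    rw [glevel]; convert hvw using 1; ring
  -- By the normalization, the recursion formula holds on the ancestor line too, so no case
  -- distinction is needed from here on.
  have gφ : ∀ x, g x = φ (p x) (g (p x)) x := fun x => by
    rcases hNx : N x with _ | n
    · obtain ⟨m, rfl⟩ := hN0 x hNx
      rw [← Function.iterate_succ_apply' p, gbase, gbase]
      refine (hφ' _ _ ?_ m rfl rfl).symm
      have := hdvd (p^[m + 1] v)
      rwa [gbase] at this
    · exact gstep n x hNx
  have gcomm : ∀ x, g (p x) = p (g x) := fun x => by
    have : p (φ (p x) (g (p x)) x) = g (p x) := (hφ _ _ (hdvd _)).mapsTo rfl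
    rw [← gφ] at this
    exact this.symm
  have ginj : Function.Injective g := by
    have key : ∀ n x y, p^[n] x = p^[n] y → g x = g y → x = y := fun n => by
      induction n with
      | zero => exact fun x y hxy _ => hxy
      | succ n ih =>
        intro x y hxy hg
        have hp : p x = p y := ih _ _ hxy (by rw [gcomm, gcomm, hg])
        refine (hφ _ _ (hdvd (p y))).injOn (show x ∈ p ⁻¹' {p y} from hp) (show y ∈ _ from rfl) ?_
        have := gφ x
        rw [hp, hg, gφ y] at this
        exact this.symm
    intro x y hxy
    obtain ⟨m, n, hmn⟩ := H.common x y
    have h1 := congrArg h hmn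
    have h2 := congrArg h hxy
    rw [H.level_iterate, H.level_iterate] at h1
    rw [glevel, glevel] at h2
    obtain rfl : m = n := by omega
    exact key m x y hmn hxy
  have gsurj : Function.Surjective g := by
    have key : ∀ n m y, p^[n] y = p^[m] w → ∃ x, g x = y := fun n m => by
      induction n with
      | zero => exact fun y hy => ⟨p^[m] v, (gbase m).trans hy.symm⟩
      | succ n ih =>
        intro y hy
        obtain ⟨x', hx'⟩ := ih (p y) hy
        obtain ⟨x, hx, hxy⟩ := (hφ _ _ (hdvd x')).surjOn (show y ∈ p ⁻¹' {g x'} from hx'.symm)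
        refine ⟨x, ?_⟩
        rw [gφ x, show p x = x' from hx, hxy]
    intro y
    obtain ⟨n, m, hnm⟩ := H.common y w
    exact key n m y hnm
  refine ⟨⟨Equiv.ofBijective g ⟨ginj, gsurj⟩, fun {x y} => ?_⟩, gcomm, glevel, gbase 0⟩
  change T.Adj (g x) (g y) ↔ T.Adj x y
  rw [H.adj_iff, H.adj_iff, ← gcomm, ← gcomm, ginj.eq_iff, ginj.eq_iff]

theorem finite_iterate_fiber (hfin : ∀ v, (p ⁻¹' {v}).Finite) (n : ℕ) (v : V) :
    {x | p^[n] x = v}.Finite := by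
  induction n generalizing v with
  | zero => exact Set.finite_singleton v
  | succ n ih =>
    refine ((ih v).biUnion fun u _ => hfin u).subset fun x hx => ?_
    exact Set.mem_biUnion (show p x ∈ {x | p^[n] x = v} from hx) rfl

end Extension

/-! ### The permutation topology -/

section Topology

variable {V : Type*} {T : SimpleGraph V}

theorem isLocallyConstant_apply (v : V) : IsLocallyConstant fun g : T ≃g T => g v := by
  let _ : TopologicalSpace V := ⊥
  have : DiscreteTopology V := ⟨rfl⟩
  rw [IsLocallyConstant.iff_continuous]
  exact (continuous_apply v).comp continuous_induced_dom

theorem continuous_iff_isLocallyConstant {X : Type*} [TopologicalSpace X] {f : X → (T ≃g T)} :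
    Continuous f ↔ ∀ v, IsLocallyConstant fun x => f x v := by
  let _ : TopologicalSpace V := ⊥
  have : DiscreteTopology V := ⟨rfl⟩
  simp only [IsLocallyConstant.iff_continuous]
  exact continuous_induced_rng.trans continuous_pi_iff

instance isTopologicalGroup_iso : IsTopologicalGroup (T ≃g T) where
  continuous_mul := by
    refine continuous_iff_isLocallyConstant.mpr fun v => ?_
    refine (IsLocallyConstant.iff_eventually_eq _).mpr fun ⟨g, k⟩ => ?_
    have h1 := (IsLocallyConstant.iff_eventually_eq _).mp (isLocallyConstant_apply (T := T) (k v)) g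
    have h2 := (IsLocallyConstant.iff_eventually_eq _).mp (isLocallyConstant_apply (T := T) v) k
    rw [nhds_prod_eq]
    filter_upwards [h1.prod_inl _, h2.prod_inr _] with ⟨g', k'⟩ h1 h2
    exact (congrArg g' h2).trans h1
  continuous_inv := by
    refine continuous_iff_isLocallyConstant.mpr fun v => ?_
    refine (IsLocallyConstant.iff_eventually_eq _).mpr fun g => ?_
    filter_upwards [(IsLocallyConstant.iff_eventually_eq _).mp
      (isLocallyConstant_apply (T := T) (g⁻¹ v)) g] with k hk
    rw [RelIso.apply_inv_self] at hk
    rw [← hk, RelIso.inv_apply_self, hk]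

instance totallyDisconnectedSpace_iso : TotallyDisconnectedSpace (T ≃g T) where
  isTotallyDisconnected_univ s _ hs g hg k hk := by
    ext v
    exact (isLocallyConstant_apply v).apply_eq_of_isPreconnected hs hg hk

variable {p : V → V} {h : V → ℤ}

/-- Fixing `v` confines each `u` to the finite set `F u`, so the stabilizer embeds in a compact
product. Its image is closed: even surjectivity is a closed condition, as a preimage of `y` can only
lie in the finite set `F y`. The level condition is automatic once `v` is fixed. -/
theorem isCompact_stabilizer_of_isParentMap (H : IsParentMap T p h)
    (hfin : ∀ v, (p ⁻¹' {v}).Finite) {r : ℤ} {G : Subgroup (T ≃g T)}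
    (hG : ∀ g, g ∈ G ↔ (∀ v, g (p v) = p (g v)) ∧ ∀ v, r ∣ h (g v) - h v) (v : V) :
    IsCompact (MulAction.stabilizer G v : Set G) := by
  let _ : TopologicalSpace V := ⊥
  have : DiscreteTopology V := ⟨rfl⟩
  choose a b hab using fun u => H.common u v
  let F : V → Set V := fun u => {x | p^[a u] x = p^[b u] v}
  have hind : Topology.IsInducing (fun (g : G) (u : V) => (g : T ≃g T) u) :=
    (Topology.IsInducing.mk rfl : Topology.IsInducing fun (g : T ≃g T) (u : V) => g u).comp
      Topology.IsInducing.subtypeVal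
  have hit : ∀ {f : V → V}, (∀ u, f (p u) = p (f u)) → ∀ n u, f (p^[n] u) = p^[n] (f u) := by
    intro f hf n u
    exact (Function.Semiconj.iterate_right (show Function.Semiconj f p p from hf) n).eq u
  have himage : (fun (g : G) (u : V) => (g : T ≃g T) u) '' (MulAction.stabilizer G v : Set G) =
      Set.univ.pi F ∩ {f | f v = v ∧ (∀ u, f (p u) = p (f u)) ∧ (∀ x y, x ≠ y → f x ≠ f y) ∧
        ∀ y, ∃ x ∈ F y, f x = y} := by
    ext f
    constructor
    · rintro ⟨g, hgv, rfl⟩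
      have hgv : (g : T ≃g T) v = v := hgv
      have hg := ((hG g).mp g.2).1
      refine ⟨fun u _ => ?_, hgv, hg, fun x y hxy => (g : T ≃g T).injective.ne hxy, fun y => ?_⟩
      · change p^[a u] _ = _
        rw [← hit hg, hab, hit hg, hgv]
      · obtain ⟨x, rfl⟩ := (g : T ≃g T).surjective y
        refine ⟨x, (g : T ≃g T).injective ?_, rfl⟩
        rw [hit hg, hit hg, hab, hgv]
    · rintro ⟨hF, hv, hp, hinj, hsurj⟩
      have hinj' : Function.Injective f := fun x y hxy => by_contra fun hne => hinj x y hne hxy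
      have hsurj' : Function.Surjective f := fun y => (hsurj y).imp fun x hx => hx.2
      let g : T ≃g T := ⟨Equiv.ofBijective f ⟨hinj', hsurj'⟩, fun {x y} => by
        change T.Adj (f x) (f y) ↔ T.Adj x y
        rw [H.adj_iff, H.adj_iff, ← hp, ← hp, hinj'.eq_iff, hinj'.eq_iff]⟩
      refine ⟨⟨g, (hG g).mpr ⟨hp, fun u => ?_⟩⟩, hv, rfl⟩
      have h1 := congrArg h (hF u trivial : p^[a u] (f u) = p^[b u] v)
      rw [← hab, H.level_iterate, H.level_iterate] at h1
      change r ∣ h (f u) - h u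
      rw [show h (f u) - h u = 0 by omega]
      exact dvd_zero r
  rw [hind.isCompact_iff, himage]
  refine (isCompact_univ_pi fun u => (finite_iterate_fiber hfin _ _).isCompact).inter_right ?_
  have hcl : ∀ (x : V) (s : Set V), IsClosed {f : V → V | f x ∈ s} := fun x s =>
    (isClosed_discrete s).preimage (continuous_apply x)
  have hcl2 : ∀ (x y : V) (s : Set (V × V)), IsClosed {f : V → V | (f x, f y) ∈ s} := fun x y s =>
    (isClosed_discrete s).preimage ((continuous_apply x).prodMk (continuous_apply y))
  simp only [Set.ofPred_and, Set.ofPred_forall]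
  refine (hcl v {v}).inter ((isClosed_iInter fun u => hcl2 (p u) u {q | q.1 = p q.2}).inter
    ((isClosed_iInter fun x => isClosed_iInter fun y => isClosed_iInter fun _ =>
      hcl2 x y {q | q.1 ≠ q.2}).inter (isClosed_iInter fun y => ?_)))
  have : {f : V → V | ∃ x ∈ F y, f x = y} = ⋃ x ∈ F y, {f | f x ∈ ({y} : Set V)} := by
    ext f; simp
  rw [this]
  exact (finite_iterate_fiber hfin _ _).isClosed_biUnion fun x _ => hcl x {y}

theorem isOpen_stabilizer_subgroup (G : Subgroup (T ≃g T)) (v : V) :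
    IsOpen (MulAction.stabilizer G v : Set G) :=
  ((isLocallyConstant_apply (T := T) v).comp_continuous continuous_subtype_val) {v}

end Topology

/-! ### Cayley–Abels graphs of topological groups -/

section CayleyAbels

open MeasureTheory Measure Pointwise

variable {G : Type*} [Group G]

theorem setOf_smul_mem_eq_biUnion {X : Type*} [MulAction G X] {a : X} {F : Finset X} {k : X → G}
    (hk : ∀ y ∈ F, k y • a = y) :
    {s : G | s • a ∈ F} = ⋃ y ∈ F, k y • (MulAction.stabilizer G a : Set G) := by
  ext s
  simp only [Set.mem_ofPred_eq, Set.mem_iUnion, Set.mem_smul_set_iff_inv_smul_mem, smul_eq_mul,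
    SetLike.mem_coe, MulAction.mem_stabilizer_iff, mul_smul, exists_prop, inv_smul_eq_iff]
  constructor
  · exact fun hs => ⟨_, hs, (hk _ hs).symm⟩
  · rintro ⟨y, hy, h⟩
    rwa [h, hk y hy]

variable [TopologicalSpace G] [IsTopologicalGroup G]

theorem isCompact_setOf_smul_mem {X : Type*} [MulAction G X] [MulAction.IsPretransitive G X] {a : X}
    (ha : IsCompact (MulAction.stabilizer G a : Set G)) (F : Finset X) :
    IsCompact {s : G | s • a ∈ F} := by
  choose k hk using MulAction.exists_smul_eq G a
  rw [setOf_smul_mem_eq_biUnion fun y _ => hk y]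
  exact F.isCompact_biUnion fun y _ => ha.smul (k y)

theorem measure_setOf_smul_mem [MeasurableSpace G] [BorelSpace G] (μ : Measure G)
    [μ.IsMulLeftInvariant] {X : Type*} [MulAction G X] {a : X}
    (ha : IsOpen (MulAction.stabilizer G a : Set G)) {F : Finset X}
    (hF : ∀ y ∈ F, ∃ k : G, k • a = y) :
    μ {s : G | s • a ∈ F} = F.card * μ (MulAction.stabilizer G a : Set G) := by
  choose! k hk using hF
  rw [setOf_smul_mem_eq_biUnion hk, measure_biUnion_finset]
  · simp [measure_smul]
  · intro y hy z hz hyz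
    refine Set.disjoint_left.mpr fun s hs hs' => hyz ?_
    rw [Set.mem_smul_set_iff_inv_smul_mem, smul_eq_mul, SetLike.mem_coe,
      MulAction.mem_stabilizer_iff, mul_smul, inv_smul_eq_iff] at hs hs'
    rw [← hk y hy, ← hs, hs', hk z hz]
  · exact fun y _ => (ha.smul (k y)).measurableSet

/-- A right translate of a Haar measure is left invariant, hence a multiple of it; the factor does
not depend on the subgroup. -/
theorem measure_mul_measure_right_translate [LocallyCompactSpace G] [MeasurableSpace G]
    [BorelSpace G] (μ : Measure G) [μ.IsHaarMeasure] {U W : Subgroup G}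
    (hU : IsCompact (U : Set G)) (hUo : IsOpen (U : Set G))
    (hW : IsCompact (W : Set G)) (hWo : IsOpen (W : Set G)) (g : G) :
    μ ((· * g) ⁻¹' U) * μ W = μ ((· * g) ⁻¹' W) * μ U := by
  have key : ∀ S : Subgroup G, IsCompact (S : Set G) → IsOpen (S : Set G) →
      μ ((· * g) ⁻¹' S) = haarScalarFactor (map (· * g) μ) μ * μ S := fun S hS hSo => by
    rw [← map_apply (measurable_mul_const g) hSo.measurableSet,
      measure_isMulInvariant_eq_smul_of_isCompact_closure _ μ hS.closure]
    rfl
  rw [key U hU hUo, key W hW hWo]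
  ring

theorem IsCayleyAbelsGraph.isCompactlyGeneratedTDLC [TotallyDisconnectedSpace G] {W : Type*}
    [MulAction G W] {Γ : SimpleGraph W} [Γ.LocallyFinite] (hΓ : IsCayleyAbelsGraph G Γ) :
    IsCompactlyGeneratedTDLC G := by
  classical
  obtain ⟨a⟩ := hΓ.connected.nonempty
  have := hΓ.vertexTransitive
  have hopen := hΓ.isOpen_stabilizer a
  have hcpt := hΓ.isCompact_stabilizer a
  refine ⟨inferInstance, hcpt.locallyCompactSpace_of_mem_nhds_of_group
    (hopen.mem_nhds (one_mem _)), inferInstance,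
    -- Including `a` itself puts its stabilizer in the generating set; connectedness handles the
    -- rest.
    {s | s • a ∈ insert a (Γ.neighborFinset a)}, isCompact_setOf_smul_mem hcpt _, ?_⟩
  set K : Set G := {s | s • a ∈ insert a (Γ.neighborFinset a)} with hK
  have hmem : ∀ s, s ∈ K ↔ s • a = a ∨ Γ.Adj a (s • a) := fun s => by simp [hK]
  have horbit : ∀ y, ∃ s ∈ Subgroup.closure K, s • a = y := fun y => by
    obtain ⟨q⟩ := hΓ.connected y a
    induction q with
    | nil => exact ⟨1, one_mem _, one_smul ..⟩
    | @cons y z _ hyz q ih =>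
      obtain ⟨s, hs, rfl⟩ := ih hopen hcpt hK hmem
      obtain ⟨k, hk⟩ := MulAction.exists_smul_eq G _ (s⁻¹ • y)
      refine ⟨s * k, mul_mem hs (Subgroup.subset_closure ((hmem k).mpr (Or.inr ?_))), ?_⟩
      · rw [hk, ← hΓ.adj_smul_iff s, smul_inv_smul]
        exact hyz.symm
      · rw [mul_smul, hk, smul_inv_smul]
  refine eq_top_iff.mpr fun g _ => ?_
  obtain ⟨s, hs, hsa⟩ := horbit (g • a)
  have : s⁻¹ * g ∈ K := (hmem _).mpr (Or.inl (by rw [mul_smul, ← hsa, inv_smul_smul]))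
  simpa using mul_mem hs (Subgroup.subset_closure this)

/-- A nontrivial continuous homomorphism to the integers bounds the degrees of the Cayley–Abels
graphs in terms of the modular function. -/
theorem IsCayleyAbelsGraph.lt_degree [LocallyCompactSpace G] {c : G → ℤ}
    (hmul : ∀ g k, c (g * k) = c g + c k) (hc : IsLocallyConstant c) (hne : ∃ g, c g ≠ 0) {Q : ℕ}
    (hQ : ∀ g, 0 < c g → ∃ U : Subgroup G, IsCompact (U : Set G) ∧ IsOpen (U : Set G) ∧
      ∀ [MeasurableSpace G] [BorelSpace G] (μ : Measure G) [μ.IsHaarMeasure],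
        Q * μ U ≤ μ ((· * g) ⁻¹' U))
    {W : Type*} [MulAction G W] {Γ : SimpleGraph W} [Γ.LocallyFinite]
    (hΓ : IsCayleyAbelsGraph G Γ) {n : ℕ} (hn : Γ.IsRegularOfDegree n) : Q + 1 ≤ n := by
  classical
  obtain ⟨a⟩ := hΓ.connected.nonempty
  have := hΓ.vertexTransitive
  have hone : c 1 = 0 := by have := hmul 1 1; rw [one_mul] at this; omega
  have hinv : ∀ g, c g⁻¹ = -c g := fun g => by
    have := hmul g g⁻¹; rw [mul_inv_cancel, hone] at this; omega
  have hpow : ∀ g (n : ℕ), c (g ^ n) = n * c g := fun g n => by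
    induction n with
    | zero => simp [hone]
    | succ n ih => rw [pow_succ, hmul, ih]; push_cast; ring
  -- A compact group has finite image under `c`, while the powers of an element with nonzero value
  -- would give infinitely many values.
  have hstab : ∀ g ∈ MulAction.stabilizer G a, c g = 0 := fun g hg => by
    by_contra hg0
    have hfin : (c '' (MulAction.stabilizer G a : Set G)).Finite :=
      ((hΓ.isCompact_stabilizer a).image hc.continuous).finite_of_discrete
    have hinj : Function.Injective fun n : ℕ => c (g ^ n) := fun m n hmn => by
      simp only [hpow] at hmn
      exact_mod_cast mul_right_cancel₀ hg0 hmn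
    exact Set.infinite_range_of_injective hinj (hfin.subset (by
      rintro _ ⟨n, rfl⟩
      exact ⟨_, pow_mem hg n, rfl⟩))
  choose t ht using MulAction.exists_smul_eq G a
  let f : W → ℤ := fun y => c (t y)
  have hf : ∀ g, f (g • a) = c g := fun g => by
    have := hstab ((t (g • a))⁻¹ * g) (by
      rw [MulAction.mem_stabilizer_iff, mul_smul, inv_smul_eq_iff, ht])
    rw [hmul, hinv] at this
    change c (t (g • a)) = c g
    omega
  obtain ⟨g, hg, hag⟩ : ∃ g, c g ≠ 0 ∧ Γ.Adj a (g • a) := by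
    by_contra! hcon
    obtain ⟨g, hg⟩ := hne
    have hedge : ∀ y z, Γ.Adj y z → f y = f z := fun y z hyz => by
      obtain ⟨k, hk⟩ := MulAction.exists_smul_eq G a ((t y)⁻¹ • z)
      have hck : c k = 0 := by
        by_contra hk0
        exact hcon k hk0 (by rwa [hk, ← hΓ.adj_smul_iff (t y), smul_inv_smul, ht])
      have hz : (t y * k) • a = z := by rw [mul_smul, hk, smul_inv_smul]
      rw [← hz, hf, hmul, hck, add_zero]
    have hconst : ∀ y z, f y = f z := fun y z => by
      obtain ⟨q⟩ := hΓ.connected y z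
      induction q with
      | nil => rfl
      | cons hyz q ih => exact (hedge _ _ hyz).trans ih
    rw [← hf, hconst _ ((1 : G) • a), hf] at hg
    exact hg hone
  obtain ⟨g, hg, hag, hag'⟩ : ∃ g, 0 < c g ∧ Γ.Adj a (g • a) ∧ Γ.Adj a (g⁻¹ • a) := by
    have hag' : Γ.Adj a (g⁻¹ • a) := by
      rw [← hΓ.adj_smul_iff g, smul_inv_smul]; exact hag.symm
    rcases lt_or_gt_of_ne hg with h | h
    · exact ⟨g⁻¹, by rw [hinv]; omega, hag', by rwa [inv_inv]⟩
    · exact ⟨g, h, hag, hag'⟩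
  obtain ⟨U, hU, hUo, hμ⟩ := hQ g hg
  let _ : MeasurableSpace G := borel G
  have : BorelSpace G := ⟨rfl⟩
  let μ : Measure G := haar
  let F : Finset W := (Γ.neighborFinset a).filter fun y => f y = -c g
  have hlt : F.card < n := by
    rw [← hn a, ← SimpleGraph.card_neighborFinset_eq_degree]
    -- The neighbour `g • a` has value `c g > 0`, so it is not counted in `F`; this is the extra one
    -- in the bound.
    refine Finset.card_lt_card (Finset.filter_ssubset.mpr ⟨g • a, by simpa using hag, ?_⟩)
    rw [hf]
    omega
  have hpos : ∀ S : Subgroup G, IsOpen (S : Set G) → μ S ≠ 0 := fun S hS =>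
    (hS.measure_pos μ ⟨1, one_mem S⟩).ne'
  have hfin := hΓ.isCompact_stabilizer a
  have hopen := hΓ.isOpen_stabilizer a
  -- The preimage is the translate of the stabilizer by `g⁻¹` on the right; it sends `a` into the
  -- orbit of `g⁻¹ • a`, which lies in `F`.
  have hle : μ ((· * g) ⁻¹' (MulAction.stabilizer G a : Set G)) ≤
      F.card * μ (MulAction.stabilizer G a : Set G) := by
    rw [← measure_setOf_smul_mem μ hopen fun y _ => MulAction.exists_smul_eq G a y]
    refine measure_mono fun s hs => ?_
    have hs : s * g ∈ MulAction.stabilizer G a := hs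
    have hsa : s • a = (s * g) • g⁻¹ • a := by rw [smul_smul, mul_inv_cancel_right]
    have hadj : Γ.Adj a (s • a) := by
      rw [hsa, ← hΓ.adj_smul_iff (s * g)⁻¹, inv_smul_smul, MulAction.mem_stabilizer_iff.mp (inv_mem hs)]
      exact hag'
    have hfs : f (s • a) = -c g := by
      have := hstab _ hs
      rw [hmul] at this
      rw [hf]
      omega
    simpa [F] using ⟨hadj, hfs⟩
  have hQF : (Q : ENNReal) ≤ F.card := by
    have h1 := measure_mul_measure_right_translate μ hU hUo hfin hopen g
    have h2 : Q * μ U * μ (MulAction.stabilizer G a : Set G) ≤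
        F.card * μ (MulAction.stabilizer G a : Set G) * μ U :=
      (mul_le_mul_left (hμ μ) _).trans (h1.le.trans (mul_le_mul_left hle _))
    rw [mul_assoc, mul_assoc, mul_comm (μ (MulAction.stabilizer G a : Set G))] at h2
    exact (ENNReal.mul_le_mul_iff_left (mul_ne_zero (hpos U hUo) (hpos _ hopen))
      (ENNReal.mul_ne_top hU.measure_ne_top hfin.measure_ne_top)).mp h2
  have : Q ≤ F.card := by exact_mod_cast hQF
  omega

end CayleyAbels

/-! ### The minimal degree of the group of automorphisms commuting with a parent map -/

section DegreeFormula

open MeasureTheory Measure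

variable {V : Type u} {T : SimpleGraph V} {p : V → V} {h : V → ℤ} {r : ℕ} {G : Subgroup (T ≃g T)}

theorem IsParentMap.exists_smul_eq (H : IsParentMap T p h) (hfin : ∀ v, (p ⁻¹' {v}).Finite)
    (hc : ∀ v w, (r : ℤ) ∣ h v - h w → (p ⁻¹' {v}).ncard = (p ⁻¹' {w}).ncard)
    (hG : ∀ g, g ∈ G ↔ (∀ v, g (p v) = p (g v)) ∧ ∀ v, (r : ℤ) ∣ h (g v) - h v) {v w : V}
    (hvw : (r : ℤ) ∣ h v - h w) : ∃ g : G, g • v = w := by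
  obtain ⟨g, hg, hgl, hgv⟩ := H.exists_iso hfin hc hvw
  refine ⟨⟨g, (hG g).mpr ⟨hg, fun v => ?_⟩⟩, hgv⟩
  rw [hgl, add_sub_cancel_left]
  exact dvd_sub_comm.mp hvw

theorem smul_iterate (hG : ∀ g ∈ G, ∀ v, g (p v) = p (g v)) (g : G) (n : ℕ) (v : V) :
    g • p^[n] v = p^[n] (g • v) :=
  (Function.Semiconj.iterate_right
    (show Function.Semiconj (g : T ≃g T) p p from hG g g.2) n).eq v

theorem IsParentMap.level_smul_sub (H : IsParentMap T p h) (hG : ∀ g ∈ G, ∀ v, g (p v) = p (g v))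
    (g : G) (v w : V) : h (g • v) - h v = h (g • w) - h w := by
  obtain ⟨m, n, hmn⟩ := H.common v w
  have h1 := congrArg h hmn
  have h2 := congrArg (fun x => h (g • x)) hmn
  simp only [smul_iterate hG, H.level_iterate] at h1 h2
  omega

/-- The automorphisms that commute with the parent map and preserve the levels modulo `r` act on the
tree formed by every `r`-th level. -/
theorem IsParentMap.mem_cayleyAbelsDegrees (H : IsParentMap T p h)
    (hfin : ∀ v, (p ⁻¹' {v}).Finite) (hr : 0 < r)
    (hc : ∀ v w, (r : ℤ) ∣ h v - h w → (p ⁻¹' {v}).ncard = (p ⁻¹' {w}).ncard)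
    (hG : ∀ g, g ∈ G ↔ (∀ v, g (p v) = p (g v)) ∧ ∀ v, (r : ℤ) ∣ h (g v) - h v) {Q : ℕ}
    (hQ : ∀ v, {x | p^[r] x = v}.ncard = Q) (o : V) : Q + 1 ∈ cayleyAbelsDegrees G := by
  have hGc := fun g hg => ((hG g).mp hg).1
  let W : Type u := {v : V // (r : ℤ) ∣ h v - h o}
  let act : MulAction G W :=
    { smul := fun g w => ⟨g • w.1, by
        have := dvd_add (((hG g).mp g.2).2 w.1) w.2
        rwa [sub_add_sub_cancel] at this⟩
      one_smul := fun w => Subtype.ext (one_smul G w.1)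
      mul_smul := fun g k w => Subtype.ext (mul_smul g k w.1) }
  have hval : ∀ (g : G) (w : W), (g • w).1 = g • w.1 := fun _ _ => rfl
  let Γ : SimpleGraph W :=
    { Adj := fun a b => b.1 = p^[r] a.1 ∨ a.1 = p^[r] b.1
      symm := ⟨fun _ _ => Or.symm⟩
      loopless := ⟨fun a ha => by
        have := congrArg h (or_self_iff.mp ha)
        rw [H.level_iterate] at this
        omega⟩ }
  have hadj : ∀ a b : W, Γ.Adj a b ↔ b.1 = p^[r] a.1 ∨ a.1 = p^[r] b.1 := fun _ _ => Iff.rfl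
  have hfinr : ∀ v, {x | p^[r] x = v}.Finite := fun v => finite_iterate_fiber hfin r v
  have hnbr : ∀ a : W, Subtype.val '' Γ.neighborSet a = insert (p^[r] a.1) {x | p^[r] x = a.1} := by
    intro a
    ext x
    simp only [Set.mem_image, SimpleGraph.mem_neighborSet, Set.mem_insert_iff, Set.mem_ofPred_eq]
    constructor
    · rintro ⟨b, hb | hb, rfl⟩
      · exact Or.inl hb
      · exact Or.inr hb.symm
    · intro hx
      refine ⟨⟨x, ?_⟩, hx.imp id Eq.symm, rfl⟩
      obtain ⟨z, hz⟩ := a.2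
      rcases hx with rfl | hx
      · exact ⟨z + 1, by rw [H.level_iterate]; linarith⟩
      · have := H.level_iterate r x
        rw [hx] at this
        exact ⟨z - 1, by linarith⟩
  let lf : Γ.LocallyFinite := fun a => (Set.Finite.of_finite_image
    (hnbr a ▸ (hfinr a.1).insert _) Subtype.val_injective.injOn).fintype
  have hdeg : Γ.IsRegularOfDegree (Q + 1) := fun a => by
    rw [← SimpleGraph.card_neighborSet_eq_degree, ← Nat.card_eq_fintype_card,
      Nat.card_coe_set_eq, ← Set.ncard_image_of_injective _ Subtype.val_injective, hnbr,
      Set.ncard_insert_of_notMem _ (hfinr a.1), hQ]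
    intro ha
    have := congrArg h (show p^[r] (p^[r] a.1) = a.1 from ha)
    rw [H.level_iterate, H.level_iterate] at this
    omega
  have hup : ∀ (k : ℕ) (a b : W), b.1 = p^[r * k] a.1 → Γ.Reachable a b := fun k => by
    induction k with
    | zero => exact fun a b hab => (Subtype.ext hab : b = a) ▸ SimpleGraph.Reachable.refl _
    | succ k ih =>
      intro a b hab
      rw [Nat.mul_succ, Function.iterate_add_apply] at hab
      obtain ⟨z, hz⟩ := a.2
      let a' : W := ⟨p^[r] a.1, z + 1, by rw [H.level_iterate]; linarith⟩
      have haa' : Γ.Adj a a' := Or.inl rfl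
      exact haa'.reachable.trans (ih a' b hab)
  refine ⟨W, act, Γ, lf, ⟨(SimpleGraph.connected_iff _).mpr ⟨fun a b => ?_, ⟨o, by simp⟩⟩, ?_, ?_,
    ?_, ?_⟩, hdeg⟩
  · obtain ⟨m, n, hmn⟩ := H.common a.1 b.1
    have hl := congrArg h hmn
    rw [H.level_iterate, H.level_iterate] at hl
    obtain ⟨x, hx⟩ := a.2
    obtain ⟨y, hy⟩ := b.2
    -- The meeting point `p^[m] a` need not lie on a level of `W`. Climbing on to the ancestor `r *
    -- m` steps above `a` repairs this, and the number of steps from `b` is then also a multiple of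
    -- `r`.
    obtain ⟨j, hj⟩ : ∃ j, j + m = r * m := ⟨r * m - m, Nat.sub_add_cancel (Nat.le_mul_of_pos_left m hr)⟩
    obtain ⟨k, hk⟩ : r ∣ j + n := by
      have : (r : ℤ) ∣ ((j + n : ℕ) : ℤ) := ⟨m + x - y, by
        have : (j : ℤ) + m = r * m := by exact_mod_cast hj
        push_cast
        linarith⟩
      exact_mod_cast this
    let c : W := ⟨p^[r * m] a.1, x + m, by rw [H.level_iterate]; push_cast; linarith⟩
    refine (hup m a c rfl).trans (hup k b c ?_).symm
    change p^[r * m] a.1 = _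
    rw [← hj, ← hk, Function.iterate_add_apply, Function.iterate_add_apply, hmn]
  · intro g a b
    rw [hadj, hadj, hval, hval, ← smul_iterate hGc, ← smul_iterate hGc,
      (MulAction.injective g).eq_iff, (MulAction.injective g).eq_iff]
  · refine ⟨fun a b => ?_⟩
    obtain ⟨g, hg⟩ := H.exists_smul_eq hfin hc hG (v := a.1) (w := b.1) (by
      have := dvd_sub a.2 b.2
      rwa [sub_sub_sub_cancel_right] at this)
    exact ⟨g, Subtype.ext hg⟩
  all_goals
    intro a
    have : MulAction.stabilizer G a = MulAction.stabilizer G a.1 := by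
      ext g
      rw [MulAction.mem_stabilizer_iff, MulAction.mem_stabilizer_iff, ← hval, Subtype.ext_iff]
    rw [this]
  · exact isCompact_stabilizer_of_isParentMap H hfin hG a.1
  · exact isOpen_stabilizer_subgroup G a.1

/-- Since `p` is surjective, `p^[r * k]` maps the `r * (k + 1)`-fold descendants of `v` onto its
`r`-fold ones. -/
theorem le_ncard_iterate_fiber (hfin : ∀ v, (p ⁻¹' {v}).Finite) (hr : 0 < r) {Q : ℕ} (hQ0 : 0 < Q)
    (hQ : ∀ v, {x | p^[r] x = v}.ncard = Q) (k : ℕ) (v : V) :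
    Q ≤ {x | p^[r * (k + 1)] x = v}.ncard := by
  have hsurj : Function.Surjective p := fun v => by
    obtain ⟨x, hx⟩ := Set.nonempty_of_ncard_ne_zero (s := {x | p^[r] x = v}) (by rw [hQ]; omega)
    obtain ⟨n, rfl⟩ := Nat.exists_eq_add_of_lt hr
    refine ⟨p^[n] x, ?_⟩
    rw [← Function.iterate_succ_apply' p]
    rwa [zero_add] at hx
  rw [← hQ v]
  refine (Set.ncard_le_ncard ?_ ((finite_iterate_fiber hfin _ v).image p^[r * k])).trans
    (Set.ncard_image_le (finite_iterate_fiber hfin _ v))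
  intro x hx
  obtain ⟨y, rfl⟩ := hsurj.iterate (r * k) x
  refine ⟨y, ?_, rfl⟩
  change p^[r * (k + 1)] y = v
  rw [Nat.mul_succ, add_comm, Function.iterate_add_apply]
  exact hx

theorem IsParentMap.isCompactlyGeneratedTDLC_and_md_eq (H : IsParentMap T p h)
    (hfin : ∀ v, (p ⁻¹' {v}).Finite) (hr : 0 < r)
    (hc : ∀ v w, (r : ℤ) ∣ h v - h w → (p ⁻¹' {v}).ncard = (p ⁻¹' {w}).ncard)
    (hG : ∀ g, g ∈ G ↔ (∀ v, g (p v) = p (g v)) ∧ ∀ v, (r : ℤ) ∣ h (g v) - h v) {Q : ℕ}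
    (hQ0 : 0 < Q) (hQ : ∀ v, {x | p^[r] x = v}.ncard = Q) (o : V) :
    IsCompactlyGeneratedTDLC G ∧ md G = Q + 1 := by
  have hmem := H.mem_cayleyAbelsDegrees hfin hr hc hG hQ o
  have hGc := fun g hg => ((hG g).mp hg).1
  have hG' : IsCompactlyGeneratedTDLC G := by
    obtain ⟨W, _, Γ, _, hΓ, -⟩ := hmem
    exact hΓ.isCompactlyGeneratedTDLC
  refine ⟨hG', le_antisymm (Nat.sInf_le hmem) (le_csInf ⟨_, hmem⟩ ?_)⟩
  rintro n ⟨W, _, Γ, _, hΓ, hn⟩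
  have := hG'.locallyCompactSpace
  have hlevel := H.level_smul_sub hGc
  refine hΓ.lt_degree (c := fun g => h (g • o) - h o) (fun g k => ?_)
    (((isLocallyConstant_apply (T := T) o).comp_continuous continuous_subtype_val).comp
      fun v => h v - h o) ?_ (fun g hg => ?_) hn
  · rw [mul_smul, ← hlevel g (k • o) o]
    ring
  · obtain ⟨g, hg⟩ := H.exists_smul_eq hfin hc hG (v := o) (w := p^[r] o)
      ⟨-1, by rw [H.level_iterate]; ring⟩
    refine ⟨g, ?_⟩
    rw [hg, H.level_iterate]
    omega
  · obtain ⟨m, n, hmn⟩ := H.common (g • o) o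
    have hl := congrArg h hmn
    rw [H.level_iterate, H.level_iterate] at hl
    obtain ⟨k, hk⟩ : ∃ k, n = r * (k + 1) + m := by
      obtain ⟨z, hz⟩ := ((hG g).mp g.2).2 o
      change h (g • o) - h o = r * z at hz
      rw [hz] at hg
      have hz0 : 0 < z := pos_of_mul_pos_right hg (by omega)
      obtain ⟨k, rfl⟩ := Int.eq_succ_of_zero_lt hz0
      refine ⟨k, ?_⟩
      have : (n : ℤ) = r * (k + 1) + m := by linarith
      exact_mod_cast this
    -- High enough on the ancestor line of `o`, `g` acts as a translation towards the end, by a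
    -- positive multiple of `r`.
    have hgv : g • p^[m] o = p^[r * (k + 1)] (p^[m] o) := by
      rw [smul_iterate hGc, hmn, hk, Function.iterate_add_apply]
    set v := p^[m] o
    refine ⟨MulAction.stabilizer G v, isCompact_stabilizer_of_isParentMap H hfin hG v,
      isOpen_stabilizer_subgroup G v, fun μ _ => ?_⟩
    -- `s * g` fixes `v` exactly when `s • v` is an `r * (k + 1)`-fold descendant of `v`, so the
    -- modular factor is the number of these.
    have hset : (· * g) ⁻¹' (MulAction.stabilizer G v : Set G) =
        {s : G | s • v ∈ (finite_iterate_fiber hfin (r * (k + 1)) v).toFinset} := by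
      ext s
      simp only [Set.mem_preimage, SetLike.mem_coe, MulAction.mem_stabilizer_iff, mul_smul, hgv,
        smul_iterate hGc, Set.Finite.mem_toFinset, Set.mem_ofPred_eq]
    rw [hset, measure_setOf_smul_mem μ (isOpen_stabilizer_subgroup G v),
      ← Set.ncard_eq_toFinset_card _ (finite_iterate_fiber hfin _ v)]
    · gcongr
      exact le_ncard_iterate_fiber hfin hr hQ0 hQ k v
    · intro y hy
      rw [Set.Finite.mem_toFinset, Set.mem_ofPred_eq] at hy
      refine H.exists_smul_eq hfin hc hG ⟨k + 1, ?_⟩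
      rw [← hy, H.level_iterate]
      push_cast
      ring

end DegreeFormula

/-! ### Regular and bi-regular trees -/

section Regular

variable {V : Type*} {T : SimpleGraph V} {p : V → V} {h : V → ℤ}

theorem IsParentMap.neighborSet_eq (H : IsParentMap T p h) (v : V) :
    T.neighborSet v = insert (p v) (p ⁻¹' {v}) := by
  ext w
  simp [H.adj_iff, eq_comm]

theorem IsParentMap.finite_fiber [T.LocallyFinite] (H : IsParentMap T p h) (v : V) :
    (p ⁻¹' {v}).Finite :=
  (T.neighborSet v).toFinite.subset (H.neighborSet_eq v ▸ Set.subset_insert _ _)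

theorem IsParentMap.ncard_fiber [T.LocallyFinite] (H : IsParentMap T p h) (v : V) :
    (p ⁻¹' {v}).ncard = T.degree v - 1 := by
  rw [← SimpleGraph.card_neighborSet_eq_degree, ← Nat.card_eq_fintype_card, Nat.card_coe_set_eq,
    H.neighborSet_eq, Set.ncard_insert_of_notMem _ (H.finite_fiber v), Nat.add_sub_cancel]
  intro hv
  have := congrArg h (show p (p v) = v from hv)
  rw [H.level, H.level] at this
  omega

theorem IsParentMap.even_dist_iff (H : IsParentMap T p h) (hT : T.Connected) (v w : V) :
    Even (T.dist v w) ↔ (2 : ℤ) ∣ h w - h v := by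
  have key : ∀ {v w} (q : T.Walk v w), Even q.length ↔ (2 : ℤ) ∣ h w - h v := fun q => by
    induction q with
    | nil => simp
    | @cons u v w huv q ih =>
      have huv : h v = h u + 1 ∨ h u = h v + 1 := by
        rcases (H.adj_iff u v).mp huv with rfl | rfl
        · exact Or.inl (H.level u)
        · exact Or.inr (H.level v)
      rw [SimpleGraph.Walk.length_cons, Nat.even_add_one, ih]
      omega
  obtain ⟨q, hq⟩ := hT.exists_walk_length_eq_dist v w
  rw [← hq, key q]

theorem IsParentMap.mem_autPlus_iff (H : IsParentMap T p h) (hT : T.Connected) (g : T ≃g T) :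
    g ∈ autPlus T ↔ ∀ v, (2 : ℤ) ∣ h (g v) - h v := by
  change (∀ v w, Even (T.dist v (g w)) ↔ Even (T.dist v w)) ↔ _
  simp only [H.even_dist_iff hT]
  refine ⟨fun hg v => (hg v v).mpr (by simp), fun hg v w => ?_⟩
  have := hg w
  omega

variable [T.LocallyFinite] {d d' : ℕ}

/-- The degree of a vertex of a bi-regular tree depends on the parity of its level. -/
theorem IsParentMap.exists_degree_eq (H : IsParentMap T p h) (hT : IsBiregular T d d') :
    ∃ A : Set V, (∀ v w, (2 : ℤ) ∣ h v - h w ↔ (v ∈ A ↔ w ∈ A)) ∧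
      (∀ v ∈ A, T.degree v = d) ∧ ∀ v ∉ A, T.degree v = d' := by
  obtain ⟨A, hA, hd, hd'⟩ := hT
  refine ⟨A, fun v w => ?_, hd, hd'⟩
  have hstep : ∀ v, v ∈ A ↔ p v ∉ A := fun v => hA _ _ ((H.adj_iff v (p v)).mpr (Or.inl rfl))
  have hiter : ∀ n v, p^[n] v ∈ A ↔ (Even n ↔ v ∈ A) := fun n v => by
    induction n with
    | zero => simp
    | succ n ih =>
      have := hstep (p^[n] v)
      rw [Function.iterate_succ_apply', Nat.even_add_one]
      tauto
  obtain ⟨m, n, hmn⟩ := H.common v w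
  have hl := congrArg h hmn
  rw [H.level_iterate, H.level_iterate] at hl
  have h1 := hiter m v
  rw [hmn, hiter n w] at h1
  have h2 : (2 : ℤ) ∣ h v - h w ↔ (Even m ↔ Even n) := by
    rw [Nat.even_iff, Nat.even_iff]
    omega
  rw [h2]
  tauto

/-- The children of `v` lie in the other part, so both degrees contribute one factor whichever part
contains `v`. -/
theorem IsParentMap.ncard_iterate_two_fiber (H : IsParentMap T p h) (hT : IsBiregular T d d')
    (v : V) : {x | p^[2] x = v}.ncard = (d - 1) * (d' - 1) := by
  classical
  obtain ⟨A, hA, hd, hd'⟩ := H.exists_degree_eq hT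
  have hAp : ∀ x, p x = v → (x ∈ A ↔ v ∉ A) := by
    rintro x rfl
    have h1 := hA x (p x)
    rw [H.level] at h1
    have : ¬ (2 : ℤ) ∣ h x - (h x + 1) := by omega
    tauto
  have hcard : ∀ c, (∀ x, p x = v → T.degree x = c) →
      {x | p^[2] x = v}.ncard = (T.degree v - 1) * (c - 1) := fun c hc => by
    have hset : {x | p^[2] x = v} = (H.finite_fiber v).toFinset.biUnion
        fun x => (H.finite_fiber x).toFinset := by
      ext x
      simp
    rw [hset, Set.ncard_coe_finset, Finset.card_biUnion, Finset.sum_congr rfl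
      (g := fun _ => c - 1), Finset.sum_const, smul_eq_mul,
      ← Set.ncard_eq_toFinset_card _ (H.finite_fiber v),
      H.ncard_fiber]
    · intro x hx
      rw [← Set.ncard_eq_toFinset_card _ (H.finite_fiber x), H.ncard_fiber, hc x (by simpa using hx)]
    · intro x _ y _ hxy
      refine Finset.disjoint_left.mpr fun z hz hz' => hxy ?_
      simp only [Set.Finite.mem_toFinset, Set.mem_preimage, Set.mem_singleton_iff] at hz hz'
      exact hz.symm.trans hz'
  by_cases hv : v ∈ A
  · rw [hcard d' fun x hx => hd' x fun hxA => (hAp x hx).mp hxA hv, hd v hv]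
  · rw [hcard d fun x hx => hd x ((hAp x hx).mpr hv), hd' v hv, mul_comm]

theorem endStabilizerPlus_isCompactlyGeneratedTDLC_and_md_eq (hT : T.IsTree) (ω : TreeEnd T)
    (hd : 2 ≤ d) (hd' : 2 ≤ d') (hb : IsBiregular T d d') :
    IsCompactlyGeneratedTDLC (endStabilizerPlus T ω) ∧
      md (endStabilizerPlus T ω) = (d - 1) * (d' - 1) + 1 := by
  obtain ⟨p, h, H, hω⟩ := exists_isParentMap hT ω
  obtain ⟨o⟩ := hT.connected.nonempty
  obtain ⟨A, hA, hAd, hAd'⟩ := H.exists_degree_eq hb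
  refine H.isCompactlyGeneratedTDLC_and_md_eq (r := 2) H.finite_fiber two_pos (fun v w hvw => ?_)
    (fun g => ?_) (Nat.mul_pos (by omega) (by omega)) (H.ncard_iterate_two_fiber hb) o
  · rw [H.ncard_fiber, H.ncard_fiber]
    have hvw := (hA v w).mp hvw
    by_cases hv : v ∈ A
    · rw [hAd v hv, hAd w (hvw.mp hv)]
    · rw [hAd' v hv, hAd' w fun hw => hv (hvw.mpr hw)]
  · rw [endStabilizerPlus, Subgroup.mem_inf, hω, H.mem_autPlus_iff hT.connected, and_comm]
    rfl

/-- Automorphisms preserve degrees, and distinct degrees tell the parts apart. -/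
theorem endStabilizerPlus_eq_endStabilizer (hT : T.IsTree) (ω : TreeEnd T) (hne : d ≠ d')
    (hb : IsBiregular T d d') : endStabilizerPlus T ω = endStabilizer T ω := by
  obtain ⟨p, h, H, -⟩ := exists_isParentMap hT ω
  obtain ⟨A, hA, hAd, hAd'⟩ := H.exists_degree_eq hb
  refine inf_eq_right.mpr fun g _ => (H.mem_autPlus_iff hT.connected g).mpr fun v => ?_
  have hdeg : T.degree (g v) = T.degree v := by
    rw [← SimpleGraph.card_neighborSet_eq_degree, ← SimpleGraph.card_neighborSet_eq_degree]
    exact (Fintype.card_congr (g.mapNeighborSet v)).symm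
  rw [hA]
  by_cases hv : v ∈ A <;> by_cases hgv : g v ∈ A <;> simp only [hv, hgv]
  · exact absurd ((hAd v hv).symm.trans (hdeg.symm.trans (hAd' _ hgv))) hne
  · exact absurd ((hAd _ hgv).symm.trans (hdeg.trans (hAd' _ hv))) hne

theorem isBiregular_of_isRegularOfDegree (hT : T.IsTree) (hd : T.IsRegularOfDegree d) :
    IsBiregular T d d := by
  obtain ⟨o⟩ := hT.connected.nonempty
  refine ⟨bipartitionPart T o, fun v w hvw => ?_, fun v _ => hd v, fun v _ => hd v⟩
  change Even (T.dist o v) ↔ ¬ Even (T.dist o w)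
  rcases hT.dist_eq_dist_add_one_of_adj o hvw with h | h <;> rw [h, Nat.even_add_one]
  exact not_not.symm

theorem endStabilizer_isCompactlyGeneratedTDLC_and_md_eq (hT : T.IsTree) (ω : TreeEnd T)
    (hd : 2 ≤ d) (hreg : T.IsRegularOfDegree d) :
    IsCompactlyGeneratedTDLC (endStabilizer T ω) ∧ md (endStabilizer T ω) = d := by
  obtain ⟨p, h, H, hω⟩ := exists_isParentMap hT ω
  obtain ⟨o⟩ := hT.connected.nonempty
  have hcard : ∀ v, (p ⁻¹' {v}).ncard = d - 1 := fun v => by rw [H.ncard_fiber, hreg v]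
  have := H.isCompactlyGeneratedTDLC_and_md_eq (r := 1) (G := endStabilizer T ω) (Q := d - 1)
    H.finite_fiber one_pos (fun v w _ => by rw [hcard, hcard]) (fun g => by simp [hω g])
    (by omega) hcard o
  rwa [Nat.sub_add_cancel (by omega)] at this

end Regular
end MinimalDegree

open MinimalDegree in
theorem mainTheorem6 {V : Type*} (T : SimpleGraph V) [T.LocallyFinite] (hT : T.IsTree)
    (ω : TreeEnd T) (d d' : ℕ) (hd : 2 ≤ d) (hd' : 2 ≤ d') :
    (d ≠ d' → IsBiregular T d d' →
      IsCompactlyGeneratedTDLC (endStabilizer T ω) ∧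
        md (endStabilizer T ω) = (d - 1) * (d' - 1) + 1) ∧
    (T.IsRegularOfDegree d →
      IsCompactlyGeneratedTDLC (endStabilizerPlus T ω) ∧
        md (endStabilizerPlus T ω) = (d - 1) ^ 2 + 1) ∧
    (T.IsRegularOfDegree d →
      IsCompactlyGeneratedTDLC (endStabilizer T ω) ∧
        md (endStabilizer T ω) = d) := by
  refine ⟨fun hne hb => ?_, fun hreg => ?_, fun hreg => ?_⟩
  · rw [← endStabilizerPlus_eq_endStabilizer hT ω hne hb]
    exact endStabilizerPlus_isCompactlyGeneratedTDLC_and_md_eq hT ω hd hd' hb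
  · rw [sq]
    exact endStabilizerPlus_isCompactlyGeneratedTDLC_and_md_eq hT ω hd hd
      (isBiregular_of_isRegularOfDegree hT hreg)
  · exact endStabilizer_isCompactlyGeneratedTDLC_and_md_eq hT ω hd hreg
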